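/- Let $V$ be a finite-dimensional complex vector space, $\Lambda\subset V$ a discrete lattice of full rank $2\dim_{\mathbb C}V$, and $T=V/\Lambda$ the corresponding complex torus. Let $\mathrm{End}(T)$ be the endomorphism ring of the complex Lie group $T$ and $\mathrm{End}^0(T)=\mathrm{End}(T)\otimes\mathbb Q$. Put $\Lambda_{\mathbb Q}=\Lambda\otimes\mathbb Q=\mathrm H_1(T,\mathbb Q)$, so that $\Lambda_{\mathbb Q}\otimes_{\mathbb Q}\mathbb R=V$ and $\mathrm{End}_{\mathbb Q}(\Lambda_{\mathbb Q})\otimes_{\mathbb Q}\mathbb R=\mathrm{End}_{\mathbb R}(V)$, and let $h:\mathbb C^*\to\mathrm{Aut}_{\mathbb R}(V)$ be the homomorphism for which $h(z)$ is multiplication by $z$. The Hodge group $\mathrm{Hdg}(T)$ is the smallest algebraic $\mathbb Q$-subgroup $G$ of $\mathrm{GL}(\Lambda_{\mathbb Q})$ whose group of real points $G(\mathbb R)\subset\mathrm{Aut}_{\mathbb R}(V)$ contains $h(\mathbb S^1)$, where $\mathbb S^1=\{z\in\mathbb C : |z|=1\}$; its $\mathbb Q$-Lie algebra is denoted $\mathrm{hdg}_T\subset\mathrm{End}_{\mathbb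 Q}(\Lambda_{\mathbb Q})$. Theorem. Suppose that $T$ is simple (i.e. $T\neq 0$ and the only complex subtori of $T$ are $0$ and $T$) and that $\mathrm{End}^0(T)=\mathbb Q$. Then $\mathrm{Hdg}(T)$ is a $\mathbb Q$-simple linear algebraic group, i.e., its $\mathbb Q$-Lie algebra $\mathrm{hdg}_T$ is simple (non-abelian, with no ideals other than $0$ and itself). -/

import Mathlib

open scoped TensorProduct

/-! The commutator bracket on an associative algebra. -/

attribute [local instance 100] LieRing.ofAssociativeRing

noncomputable section

/-! ### Closed algebraic subgroups of `GL(W)` over `ℚ` and their Lie algebras -/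

section AlgebraicGroups

universe u

/-- The group `GL(W)(R)` of `R`-points of the general linear group of a finite-dimensional
`ℚ`-vector space `W`: the units of `R ⊗ End_ℚ(W)` (which is `End_R(R ⊗ W)`). -/
abbrev GLPoints (W : Type u) [AddCommGroup W] [Module ℚ W] (R : Type) [CommRing R] [Algebra ℚ R] :
    Type u :=
  (R ⊗[ℚ] Module.End ℚ W)ˣ

/-- The base change map `GL(W)(R) → GL(W)(S)` of a `ℚ`-algebra homomorphism `R → S`. -/
def GLPoints.map (W : Type u) [AddCommGroup W] [Module ℚ W] {R S : Type}
    [CommRing R] [Algebra ℚ R] [CommRing S] [Algebra ℚ S] (f : R →ₐ[ℚ] S) :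
    GLPoints W R →* GLPoints W S :=
  Units.map (Algebra.TensorProduct.map f (AlgHom.id ℚ (Module.End ℚ W))).toRingHom.toMonoidHom

/-- The `R`-valued coordinate on `R ⊗ End_ℚ(W)` given by a `ℚ`-linear functional `ℓ` on
`End_ℚ(W)`: it sends `r ⊗ u` to `ℓ(u) r`. -/
def endCoord {W : Type u} [AddCommGroup W] [Module ℚ W] (R : Type) [CommRing R] [Algebra ℚ R]
    (x : R ⊗[ℚ] Module.End ℚ W) (l : Module.Dual ℚ (Module.End ℚ W)) : R :=
  TensorProduct.rid ℚ R (LinearMap.lTensor R l x)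

/-- The value at a point of `R ⊗ End_ℚ(W)` of a polynomial function on `End_ℚ(W)` with rational
coefficients.  Such a function is written as a polynomial in the linear functionals on
`End_ℚ(W)`. -/
def evalPoly {W : Type u} [AddCommGroup W] [Module ℚ W] (R : Type) [CommRing R] [Algebra ℚ R]
    (x : R ⊗[ℚ] Module.End ℚ W) (p : MvPolynomial (Module.Dual ℚ (Module.End ℚ W)) ℚ) : R :=
  MvPolynomial.aeval (endCoord R x) p

/-- An algebraic `ℚ`-subgroup of `GL(W)`: a subgroup functor of `R ↦ GL(W)(R)` on commutative
`ℚ`-algebras which is cut out by polynomial equations with rational coefficients.  (Finitely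
generated `ℚ`-algebras all have copies in `Type`, so test algebras in `Type` suffice; over `ℚ`
algebraic groups are automatically reduced.) -/
structure AlgSubgroupGL (W : Type u) [AddCommGroup W] [Module ℚ W] where
  /-- The group of `R`-points. -/
  points : ∀ (R : Type) [CommRing R] [Algebra ℚ R], Subgroup (GLPoints W R)
  closed : ∃ S : Set (MvPolynomial (Module.Dual ℚ (Module.End ℚ W)) ℚ),
    ∀ (R : Type) [CommRing R] [Algebra ℚ R] (g : GLPoints W R),
      g ∈ points R ↔ ∀ p ∈ S, evalPoly R (g : R ⊗[ℚ] Module.End ℚ W) p = 0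

/-- Inclusion of algebraic subgroups. -/
instance (W : Type u) [AddCommGroup W] [Module ℚ W] : LE (AlgSubgroupGL W) :=
  ⟨fun G H => ∀ (R : Type) [CommRing R] [Algebra ℚ R], G.points R ≤ H.points R⟩

/-- The intersection of all algebraic `ℚ`-subgroups of `GL(W)` in a given class. -/
def AlgSubgroupGL.inter {W : Type u} [AddCommGroup W] [Module ℚ W]
    (P : AlgSubgroupGL W → Prop) : AlgSubgroupGL W where
  points R _ _ := ⨅ G : {G : AlgSubgroupGL W // P G}, G.1.points R
  closed := by
    refine ⟨{p | ∃ G : {G : AlgSubgroupGL W // P G}, p ∈ G.1.closed.choose}, ?_⟩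
    intro R _ _ g
    rw [Subgroup.mem_iInf]
    constructor
    · rintro h p ⟨G, hp⟩
      exact (G.1.closed.choose_spec R g).1 (h G) p hp
    · intro h G
      exact (G.1.closed.choose_spec R g).2 fun p hp => h p ⟨G, hp⟩

variable {W : Type u} [AddCommGroup W] [Module ℚ W]

theorem endCoord_map {R S : Type} [CommRing R] [Algebra ℚ R] [CommRing S] [Algebra ℚ S]
    (f : R →ₐ[ℚ] S) (x : R ⊗[ℚ] Module.End ℚ W) (l : Module.Dual ℚ (Module.End ℚ W)) :
    endCoord S (Algebra.TensorProduct.map f (AlgHom.id ℚ (Module.End ℚ W)) x) l =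
      f (endCoord R x l) := by
  induction x using TensorProduct.induction_on with
  | zero => simp [endCoord]
  | tmul r u => simp [endCoord]
  | add x y hx hy =>
    simp only [endCoord, map_add] at hx hy ⊢
    rw [hx, hy]

theorem evalPoly_map {R S : Type} [CommRing R] [Algebra ℚ R] [CommRing S] [Algebra ℚ S]
    (f : R →ₐ[ℚ] S) (x : R ⊗[ℚ] Module.End ℚ W)
    (p : MvPolynomial (Module.Dual ℚ (Module.End ℚ W)) ℚ) :
    evalPoly S (Algebra.TensorProduct.map f (AlgHom.id ℚ (Module.End ℚ W)) x) p =
      f (evalPoly R x p) := by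
  unfold evalPoly
  have h : (fun l => f (endCoord R x l)) =
      endCoord S (Algebra.TensorProduct.map f (AlgHom.id ℚ (Module.End ℚ W)) x) :=
    funext fun l => (endCoord_map f x l).symm
  rw [← h, ← MvPolynomial.comp_aeval]
  rfl

theorem AlgSubgroupGL.map_mem (G : AlgSubgroupGL W) {R S : Type} [CommRing R] [Algebra ℚ R]
    [CommRing S] [Algebra ℚ S] (f : R →ₐ[ℚ] S) {g : GLPoints W R} (hg : g ∈ G.points R) :
    GLPoints.map W f g ∈ G.points S := by
  obtain ⟨E, hE⟩ := G.closed
  rw [hE] at hg ⊢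
  intro p hp
  have := evalPoly_map f (g : R ⊗[ℚ] Module.End ℚ W) p
  rw [hg p hp, map_zero] at this
  exact this

theorem AlgSubgroupGL.mem_of_map_mem (G : AlgSubgroupGL W) {R S : Type} [CommRing R] [Algebra ℚ R]
    [CommRing S] [Algebra ℚ S] (f : R →ₐ[ℚ] S) (hf : Function.Injective f) {g : GLPoints W R}
    (hg : GLPoints.map W f g ∈ G.points S) : g ∈ G.points R := by
  obtain ⟨E, hE⟩ := G.closed
  rw [hE] at hg ⊢
  intro p hp
  apply hf
  rw [map_zero, ← hg p hp]
  exact (evalPoly_map f (g : R ⊗[ℚ] Module.End ℚ W) p).symm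

/-- The point `1 + e X` of `GL(W)(R)`, for an element `e` of `R` of square zero. -/
def oneAdd {R : Type} [CommRing R] [Algebra ℚ R] (e : R) (he : e * e = 0)
    (X : Module.End ℚ W) : GLPoints W R where
  val := 1 + e ⊗ₜ X
  inv := 1 - e ⊗ₜ X
  val_inv := by
    have : (e ⊗ₜ[ℚ] X) * (e ⊗ₜ[ℚ] X) = 0 := by
      rw [Algebra.TensorProduct.tmul_mul_tmul, he, TensorProduct.zero_tmul]
    rw [add_mul, mul_sub, mul_sub, this]; simp
  inv_val := by
    have : (e ⊗ₜ[ℚ] X) * (e ⊗ₜ[ℚ] X) = 0 := by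
      rw [Algebra.TensorProduct.tmul_mul_tmul, he, TensorProduct.zero_tmul]
    rw [sub_mul, mul_add, mul_add, this]; simp

theorem oneAdd_map {R S : Type} [CommRing R] [Algebra ℚ R] [CommRing S] [Algebra ℚ S]
    (f : R →ₐ[ℚ] S) (e : R) (he : e * e = 0) (e' : S) (he' : e' * e' = 0) (h : f e = e')
    (X : Module.End ℚ W) : GLPoints.map W f (oneAdd e he X) = oneAdd e' he' X := by
  subst h
  ext1
  simp [GLPoints.map, oneAdd]

theorem oneAdd_mul {R : Type} [CommRing R] [Algebra ℚ R] (e : R) (he : e * e = 0)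
    (X Y : Module.End ℚ W) : oneAdd e he X * oneAdd e he Y = oneAdd e he (X + Y) := by
  ext1
  simp only [oneAdd, Units.val_mul, add_mul, mul_add, Algebra.TensorProduct.tmul_mul_tmul, he,
    TensorProduct.zero_tmul, TensorProduct.tmul_add, one_mul, mul_one, add_zero]
  abel

theorem oneAdd_comm {R : Type} [CommRing R] [Algebra ℚ R] (a b : R) (ha : a * a = 0)
    (hb : b * b = 0) (hab : (a * b) * (a * b) = 0) (X Y : Module.End ℚ W) :
    oneAdd a ha X * oneAdd b hb Y * (oneAdd a ha X)⁻¹ * (oneAdd b hb Y)⁻¹ =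
      oneAdd (a * b) hab ⁅X, Y⁆ := by
  rw [mul_inv_eq_iff_eq_mul, mul_inv_eq_iff_eq_mul]
  ext1
  have h1 : a * b * a = 0 := by rw [mul_right_comm, ha, zero_mul]
  have h2 : a * b * b = 0 := by rw [mul_assoc, hb, mul_zero]
  simp only [oneAdd, Units.val_mul, add_mul, mul_add, Algebra.TensorProduct.tmul_mul_tmul, h1, h2,
    TensorProduct.zero_tmul, one_mul, mul_one, zero_mul, Ring.lie_def,
    TensorProduct.tmul_sub, mul_comm b a, sub_mul]
  abel

/-- The homomorphism `ℚ[ε] → R` sending `ε` to an element of square zero. -/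
def dualHom {R : Type} [CommRing R] [Algebra ℚ R] (e : R) (he : e * e = 0) : DualNumber ℚ →ₐ[ℚ] R :=
  DualNumber.lift ⟨(Algebra.ofId ℚ R, e), he, fun _ => Commute.all _ _⟩

theorem dualHom_eps {R : Type} [CommRing R] [Algebra ℚ R] (e : R) (he : e * e = 0) :
    dualHom e he DualNumber.eps = e :=
  DualNumber.lift_apply_eps _

/-- The point `1 + εX` of `GL(W)` over the dual numbers `ℚ[ε]`. -/
def oneAddEps (X : Module.End ℚ W) : GLPoints W (DualNumber ℚ) :=
  oneAdd DualNumber.eps DualNumber.eps_mul_eps X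

theorem dualHom_oneAddEps {R : Type} [CommRing R] [Algebra ℚ R] (e : R) (he : e * e = 0)
    (X : Module.End ℚ W) : GLPoints.map W (dualHom e he) (oneAddEps X) = oneAdd e he X :=
  oneAdd_map _ _ _ e he (dualHom_eps e he) X

theorem AlgSubgroupGL.lie_mem_aux (G : AlgSubgroupGL W) {R : Type} [CommRing R] [Algebra ℚ R]
    (a b : R) (ha : a * a = 0) (hb : b * b = 0)
    (hab : ∀ x y : ℚ, algebraMap ℚ R x + y • (a * b) = 0 → x = 0 ∧ y = 0)
    {X Y : Module.End ℚ W} (hX : oneAddEps X ∈ G.points (DualNumber ℚ))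
    (hY : oneAddEps Y ∈ G.points (DualNumber ℚ)) :
    oneAddEps ⁅X, Y⁆ ∈ G.points (DualNumber ℚ) := by
  have hc : (a * b) * (a * b) = 0 := by rw [mul_mul_mul_comm, ha, zero_mul]
  have h1 := G.map_mem (dualHom a ha) hX
  have h2 := G.map_mem (dualHom b hb) hY
  rw [dualHom_oneAddEps] at h1 h2
  have h3 := mul_mem (mul_mem (mul_mem h1 h2) (inv_mem h1)) (inv_mem h2)
  rw [oneAdd_comm a b ha hb hc] at h3
  refine G.mem_of_map_mem (dualHom (a * b) hc) ?_ ?_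
  · rw [injective_iff_map_eq_zero]
    intro x hx
    have hx' : dualHom (a * b) hc x = algebraMap ℚ _ x.fst + x.snd • (a * b) := by
      simp [dualHom, DualNumber.lift_apply_apply, Algebra.ofId_apply, Algebra.smul_def]
    rw [hx'] at hx
    exact TrivSqZeroExt.ext (hab _ _ hx).1 (hab _ _ hx).2
  · rw [dualHom_oneAddEps]
    exact h3

/-- The Lie algebra of an algebraic `ℚ`-subgroup `G` of `GL(W)`: all `X ∈ End_ℚ(W)` such that
`1 + εX` is a point of `G` over the dual numbers `ℚ[ε]`. -/
def AlgSubgroupGL.lie (G : AlgSubgroupGL W) : LieSubalgebra ℚ (Module.End ℚ W) where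
  carrier := {X | oneAddEps X ∈ G.points (DualNumber ℚ)}
  zero_mem' := by
    have h : oneAddEps (0 : Module.End ℚ W) = 1 := by
      ext1; simp [oneAddEps, oneAdd]
    rw [Set.mem_ofPred_eq, h]
    exact one_mem _
  add_mem' {X Y} hX hY := by
    have h : oneAddEps (X + Y) = oneAddEps X * oneAddEps Y := (oneAdd_mul _ _ X Y).symm
    rw [Set.mem_ofPred_eq, h]
    exact mul_mem hX hY
  smul_mem' c X hX := by
    have hc : (c • DualNumber.eps : DualNumber ℚ) * (c • DualNumber.eps) = 0 := by
      rw [smul_mul_smul_comm, DualNumber.eps_mul_eps, smul_zero]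
    have h : oneAddEps (c • X) = GLPoints.map W (dualHom _ hc) (oneAddEps X) := by
      rw [dualHom_oneAddEps]
      ext1
      simp [oneAddEps, oneAdd, TensorProduct.smul_tmul]
    rw [Set.mem_ofPred_eq, h]
    exact G.map_mem _ hX
  lie_mem' {X Y} hX hY := by
    refine G.lie_mem_aux (R := DualNumber (DualNumber ℚ))
      (TrivSqZeroExt.inl DualNumber.eps) DualNumber.eps ?_ DualNumber.eps_mul_eps ?_ hX hY
    · rw [← TrivSqZeroExt.inl_mul, DualNumber.eps_mul_eps, TrivSqZeroExt.inl_zero]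
    · intro x y hx
      have e1 := congrArg (fun t => t.fst.fst) hx
      have e2 := congrArg (fun t => t.snd.snd) hx
      exact ⟨by simpa [TrivSqZeroExt.algebraMap_eq_inl'] using e1,
        by simpa [TrivSqZeroExt.algebraMap_eq_inl'] using e2⟩

end AlgebraicGroups

/-! ### Complex tori -/

namespace ComplexTorus

universe v

variable {V : Type v} [NormedAddCommGroup V] [NormedSpace ℂ V]

/-- A map of the complex torus `V / Λ` to itself is holomorphic if, locally on `V`, it lifts to a
holomorphic map of `V` (the local inverses of `V → V / Λ` are the charts of `V / Λ`). -/
def IsHolomorphic (Λ : Submodule ℤ V) (f : V ⧸ Λ → V ⧸ Λ) : Prop :=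
  ∀ x : V, ∃ F : V → V, AnalyticAt ℂ F x ∧
    ∀ᶠ y in nhds x, Submodule.Quotient.mk (p := Λ) (F y) = f (Submodule.Quotient.mk y)

/-- The ring `End(T)` of endomorphisms of the complex Lie group `T = V / Λ`. -/
def endRing (Λ : Submodule ℤ V) : Subring (AddMonoid.End (V ⧸ Λ)) where
  carrier := {f | IsHolomorphic Λ f}
  one_mem' x := ⟨id, analyticAt_id, by simp⟩
  zero_mem' x := ⟨fun _ => 0, analyticAt_const, by simp⟩
  add_mem' {f g} hf hg x := by
    obtain ⟨F, hF, hF'⟩ := hf x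
    obtain ⟨G, hG, hG'⟩ := hg x
    refine ⟨F + G, hF.add hG, ?_⟩
    filter_upwards [hF', hG'] with y h1 h2
    change Submodule.Quotient.mk (F y + G y) = f _ + g _
    rw [Submodule.Quotient.mk_add, h1, h2]
  neg_mem' {f} hf x := by
    obtain ⟨F, hF, hF'⟩ := hf x
    refine ⟨-F, hF.neg, ?_⟩
    filter_upwards [hF'] with y h1
    change Submodule.Quotient.mk (-F y) = -f _
    rw [Submodule.Quotient.mk_neg, h1]
  mul_mem' {f g} hf hg x := by
    obtain ⟨G, hG, hG'⟩ := hg x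
    obtain ⟨F, hF, hF'⟩ := hf (G x)
    refine ⟨F ∘ G, hF.comp hG, ?_⟩
    filter_upwards [hG', hG.continuousAt.eventually hF'] with y h1 h2
    simp [h1, h2]

/-- The endomorphism algebra `End⁰(T) = End(T) ⊗ ℚ`. -/
abbrev endAlgebra (Λ : Submodule ℤ V) : Type v := ℚ ⊗[ℤ] endRing Λ

/-- The condition `End⁰(T) = ℚ`. -/
def EndAlgebraEqRat (Λ : Submodule ℤ V) : Prop :=
  Function.Bijective (algebraMap ℚ (endAlgebra Λ))

/-- The complex subspace `U` of `V` defines a complex subtorus `U / (U ∩ Λ)` of `V / Λ`: the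
discrete group `U ∩ Λ` is a lattice in `U`, i.e. it spans `U` over `ℝ`. -/
def IsSubtorus (Λ : Submodule ℤ V) (U : Submodule ℂ V) : Prop :=
  Submodule.span ℝ ((U : Set V) ∩ (Λ : Set V)) = U.restrictScalars ℝ

/-- The complex torus `V / Λ` is simple: it is nonzero, and it has no complex subtori except `0`
and itself. -/
def IsSimple (Λ : Submodule ℤ V) : Prop :=
  Nontrivial V ∧ ∀ U : Submodule ℂ V, IsSubtorus Λ U → U = ⊥ ∨ U = ⊤

/-- The rational homology `Λ_ℚ = Λ ⊗ ℚ = H₁(T, ℚ)`. -/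
abbrev RatLattice (Λ : Submodule ℤ V) : Type v := ℚ ⊗[ℤ] Λ

variable [FiniteDimensional ℂ V] (Λ : Submodule ℤ V) [DiscreteTopology Λ] [IsZLattice ℝ Λ]

instance : Module.Finite ℤ Λ :=
  haveI : FiniteDimensional ℝ V := FiniteDimensional.complexToReal V
  inferInstance

instance : Module.Free ℤ Λ :=
  haveI : FiniteDimensional ℝ V := FiniteDimensional.complexToReal V
  inferInstance

/-- The canonical isomorphism `ℝ ⊗ Λ ≃ V`, `r ⊗ x ↦ r x`. -/
def realLatticeEquiv : ℝ ⊗[ℤ] Λ ≃ₗ[ℝ] V :=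
  LinearEquiv.ofBijective
    (TensorProduct.AlgebraTensorModule.lift
      ((LinearMap.toSpanSingleton ℝ (Λ →ₗ[ℤ] V) Λ.subtype))) (by
    have : FiniteDimensional ℝ V := FiniteDimensional.complexToReal V
    let b := Module.Free.chooseBasis ℤ Λ
    let e := (b.baseChange ℝ).equiv (b.ofZLatticeBasis ℝ Λ) (Equiv.refl _)
    convert! e.bijective using 1
    have : TensorProduct.AlgebraTensorModule.lift
        ((LinearMap.toSpanSingleton ℝ (Λ →ₗ[ℤ] V) Λ.subtype)) = e.toLinearMap := by
      apply (b.baseChange ℝ).ext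
      intro i
      have : e (b.baseChange ℝ i) = b.ofZLatticeBasis ℝ Λ i := by
        simp only [e, Module.Basis.equiv_apply, Equiv.refl_apply]
      rw [LinearEquiv.coe_coe, this]
      simp
    rw [this]
    rfl)

/-- The canonical isomorphism `Λ_ℝ = ℝ ⊗ Λ_ℚ ≃ V`, `r ⊗ (q ⊗ x) ↦ r q x`. -/
def realEquiv : ℝ ⊗[ℚ] RatLattice Λ ≃ₗ[ℝ] V :=
  (TensorProduct.AlgebraTensorModule.cancelBaseChange ℤ ℚ ℝ ℝ Λ).trans (realLatticeEquiv Λ)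

theorem realEquiv_tmul (r : ℝ) (q : ℚ) (x : Λ) :
    realEquiv Λ (r ⊗ₜ (q ⊗ₜ x)) = (r * (q : ℝ)) • (x : V) := by
  simp [realEquiv, realLatticeEquiv, Algebra.smul_def, mul_comm]

/-- The canonical isomorphism `ℝ ⊗ End_ℚ(Λ_ℚ) ≃ End_ℝ(V)`, under which `r ⊗ u` acts on
`V = ℝ ⊗ Λ_ℚ` by `s ⊗ x ↦ r s ⊗ u(x)`. -/
def realEndEquiv : ℝ ⊗[ℚ] Module.End ℚ (RatLattice Λ) ≃ₐ[ℝ] Module.End ℝ V :=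
  (AlgEquiv.ofBijective (LinearMap.tensorProductEnd ℚ ℝ (RatLattice Λ)) (by
    have : Module.FinitePresentation ℚ (RatLattice Λ) :=
      Module.finitePresentation_of_finite ℚ (RatLattice Λ)
    have h := Module.FinitePresentation.isBaseChange_map ℚ (RatLattice Λ) (RatLattice Λ) ℝ
    convert! h.equiv.bijective using 1)).trans ((realEquiv Λ).conjAlgEquiv ℝ)

theorem realEndEquiv_tmul (r : ℝ) (u : Module.End ℚ (RatLattice Λ)) (s : ℝ) (x : RatLattice Λ) :
    realEndEquiv Λ (r ⊗ₜ u) (realEquiv Λ (s ⊗ₜ x)) = realEquiv Λ ((r * s) ⊗ₜ u x) := by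
  have h : LinearMap.tensorProductEnd ℚ ℝ (RatLattice Λ) (r ⊗ₜ u) =
      r • LinearMap.baseChange ℝ u := rfl
  have h' : realEndEquiv Λ (r ⊗ₜ u) = (realEquiv Λ).conjAlgEquiv ℝ
      (LinearMap.tensorProductEnd ℚ ℝ (RatLattice Λ) (r ⊗ₜ u)) := rfl
  rw [h', h, ← smul_eq_mul, ← TensorProduct.smul_tmul', map_smul (realEquiv Λ)]
  simp

/-- The homomorphism `h : ℂˣ → GL(Λ_ℚ)(ℝ) = Aut_ℝ(V)`: `h(z)` is multiplication by `z` in `V`. -/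
def hodgeHom : ℂˣ →* GLPoints (RatLattice Λ) ℝ :=
  Units.map (((realEndEquiv Λ).symm : Module.End ℝ V →* _).comp
    (Algebra.lsmul ℝ ℝ V : ℂ →ₐ[ℝ] Module.End ℝ V))

theorem realEndEquiv_hodgeHom (z : ℂˣ) (v : V) :
    realEndEquiv Λ (hodgeHom Λ z : ℝ ⊗[ℚ] Module.End ℚ (RatLattice Λ)) v = (z : ℂ) • v := by
  simp [hodgeHom]

/-- The group of real points of `G` contains `h(S¹)`. -/
def ContainsHodgeCircle (G : AlgSubgroupGL (RatLattice Λ)) : Prop :=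
  ∀ z : Circle, hodgeHom Λ (Circle.toUnits z) ∈ G.points ℝ

/-- The Hodge group `Hdg(T)` of `T = V / Λ`: the smallest algebraic `ℚ`-subgroup of `GL(Λ_ℚ)` whose
group of real points contains `h(S¹)`. -/
def hodgeGroup : AlgSubgroupGL (RatLattice Λ) :=
  AlgSubgroupGL.inter (ContainsHodgeCircle Λ)

theorem hodgeGroup_contains : ContainsHodgeCircle Λ (hodgeGroup Λ) := by
  intro z
  exact Subgroup.mem_iInf.2 fun G => G.2 z

theorem hodgeGroup_le (G : AlgSubgroupGL (RatLattice Λ)) (hG : ContainsHodgeCircle Λ G) :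
    hodgeGroup Λ ≤ G := by
  intro R _ _
  exact iInf_le (fun G : {G // ContainsHodgeCircle Λ G} => G.1.points R) ⟨G, hG⟩

/-- The `ℚ`-Lie algebra `hdg_T` of the Hodge group. -/
abbrev hodgeLie : LieSubalgebra ℚ (Module.End ℚ (RatLattice Λ)) := (hodgeGroup Λ).lie

end ComplexTorus

end

/-! The complex structure `J` on `V = Λ_ℝ` is the derivative at `t = 0` of `h(e^{it})`, so it lies
in `hdg_T ⊗ ℝ` (`complexStructure_mem_span`). Three consequences of the hypotheses feed the
argument. A subspace of `Λ_ℚ` stable under `hdg_T` spans a `J`-stable real subspace, hence a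
subtorus, so simplicity of `T` makes `Λ_ℚ` irreducible (`hodgeLie_irreducible`). A rational
endomorphism commuting with `J` has an integer multiple in `End(T)`, so it is a scalar
(`exists_eq_smul_one_of_commute`). Finally `h(S¹)` has determinant one, so `hdg_T` is traceless
(`trace_eq_zero_of_mem_hodgeLie`). Therefore `hdg_T` is semisimple and acts absolutely irreducibly.

Let `I` be an ideal with complementary ideal `I'`, and split `J = a + c` along `I_ℝ ⊕ I'_ℝ`.
Bracketing `J² = -1` with `x ∈ I` and then with `z ∈ I'` leaves `2[a, x][c, z] = 0`. By
irreducibility one of the two families of brackets vanishes (`commute_or_commute_of_sq_eq_neg_one`),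
so `J` commutes with `I` or with `I'`. That ideal then consists of traceless scalars, hence is zero
(`LieSubalgebra.isSimple_of_sq_eq_neg_one`). -/

/-! ### Absolute irreducibility and commuting families of endomorphisms -/

section Linear

variable {k K W : Type*} [Field k] [Field K] [Algebra k K] [AddCommGroup W] [Module k W]

/-- Burnside's theorem, with the scalar commutant replacing algebraic closedness: `W` is a simple
`A`-module whose endomorphisms are scalars, so every `f` commutes with them, and Jacobson density
puts `f` in `A`. -/
theorem Algebra.adjoin_eq_top_of_irreducible_of_commutant [FiniteDimensional k W] [Nontrivial W]
    (S : Set (Module.End k W))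
    (hirr : ∀ U : Submodule k W, (∀ x ∈ S, ∀ u ∈ U, x u ∈ U) → U = ⊥ ∨ U = ⊤)
    (hcomm : ∀ X : Module.End k W, (∀ x ∈ S, Commute X x) → ∃ c : k, X = c • 1) :
    Algebra.adjoin k S = ⊤ := by
  set A := Algebra.adjoin k S
  have hS : ∀ x ∈ S, x ∈ A := fun x hx => Algebra.subset_adjoin hx
  have : IsSimpleModule A W := by
    have : Nontrivial (Submodule A W) := inferInstance
    refine { eq_bot_or_eq_top := fun N => ?_ }
    rcases hirr (N.restrictScalars k) (fun x hx u hu => N.smul_mem ⟨x, hS x hx⟩ hu) with h | h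
    · left; simpa using h
    · right; simpa using h
  have : Module.Finite (Module.End A W) W := by
    have : IsScalarTower k (Module.End A W) W := ⟨fun a b c => rfl⟩
    exact Module.Finite.of_restrictScalars_finite k _ W
  refine Algebra.eq_top_iff.2 fun f => ?_
  let g : Module.End (Module.End A W) W :=
    { f with
      map_smul' := fun φ w => by
        obtain ⟨c, hc⟩ := hcomm (φ.restrictScalars k) (fun x hx => by
          ext w
          exact φ.map_smul (⟨x, hS x hx⟩ : A) w)
        have h : ∀ w, φ w = c • w := fun w => congr($hc w)
        simp [h] }
  obtain ⟨a, ha⟩ := Module.Finite.toModuleEnd_moduleEnd_surjective (R := A) (M := W) g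
  have : f = a := by
    ext w
    exact congr($ha w).symm
  have ha : f ∈ A := this ▸ a.2
  exact ha

/-- Matrix units are already defined over `k`, and they carry a nonzero coordinate of a vector of
`P` to every basis vector. -/
theorem Submodule.eq_bot_or_eq_top_of_forall_baseChange_mem [FiniteDimensional k W]
    (P : Submodule K (K ⊗[k] W))
    (hP : ∀ f : Module.End k W, ∀ p ∈ P, f.baseChange K p ∈ P) : P = ⊥ ∨ P = ⊤ := by
  rw [or_iff_not_imp_left]
  intro hne
  obtain ⟨p, hp, hp0⟩ := P.exists_mem_ne_zero_of_ne_bot hne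
  let b := Module.finBasis k W
  let B := b.baseChange K
  obtain ⟨i, hi⟩ : ∃ i, B.repr p i ≠ 0 := by
    by_contra! h
    exact hp0 (B.repr.map_eq_zero_iff.1 (Finsupp.ext h))
  rw [eq_top_iff, ← B.span_eq, Submodule.span_le]
  rintro _ ⟨j, rfl⟩
  have key : ∀ q, ((b.coord i).smulRight (b j)).baseChange K q = B.repr q i • B j := by
    intro q
    induction q using TensorProduct.induction_on with
    | zero => simp
    | tmul r w => simp [B, TensorProduct.smul_tmul', Algebra.smul_def, mul_comm]
    | add x y hx hy => rw [map_add, hx, hy, map_add, Finsupp.add_apply, add_smul]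
  have := hP ((b.coord i).smulRight (b j)) p hp
  rw [key] at this
  exact (P.smul_mem_iff hi).1 this

/-- Irreducibility survives every field extension because `S` already generates all of `End_k(W)`.
-/
theorem Submodule.eq_bot_or_eq_top_of_baseChange_stable [FiniteDimensional k W] [Nontrivial W]
    (S : Set (Module.End k W))
    (hirr : ∀ U : Submodule k W, (∀ x ∈ S, ∀ u ∈ U, x u ∈ U) → U = ⊥ ∨ U = ⊤)
    (hcomm : ∀ X : Module.End k W, (∀ x ∈ S, Commute X x) → ∃ c : k, X = c • 1)
    (P : Submodule K (K ⊗[k] W))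
    (hP : ∀ x ∈ S, ∀ p ∈ P, x.baseChange K p ∈ P) : P = ⊥ ∨ P = ⊤ := by
  refine Submodule.eq_bot_or_eq_top_of_forall_baseChange_mem P fun f => ?_
  have hf : f ∈ Algebra.adjoin k S := by
    rw [Algebra.adjoin_eq_top_of_irreducible_of_commutant S hirr hcomm]; trivial
  induction hf using Algebra.adjoin_induction with
  | mem x hx => exact hP x hx
  | algebraMap r =>
    intro p hp
    rw [Algebra.algebraMap_eq_smul_one, LinearMap.baseChange_smul, LinearMap.baseChange_one]
    simpa using P.smul_mem (algebraMap k K r) hp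
  | add x y _ _ hx hy =>
    intro p hp
    rw [LinearMap.baseChange_add]
    exact P.add_mem (hx p hp) (hy p hp)
  | mul x y _ _ hx hy =>
    intro p hp
    rw [LinearMap.baseChange_mul]
    exact hx _ (hy p hp)

/-- If a square root `a + c` of `-1` is the sum of parts belonging to two commuting sets of
endomorphisms which jointly act irreducibly, then one of the parts is central. -/
theorem commute_or_commute_of_sq_eq_neg_one {V : Type*} [AddCommGroup V] [Module K V]
    [NeZero (2 : K)] (S S' : Set (Module.End K V)) (a c : Module.End K V)
    (hsq : (a + c) * (a + c) = -1)
    (hirr : ∀ P : Submodule K V, (∀ x ∈ S, ∀ p ∈ P, x p ∈ P) → (∀ z ∈ S', ∀ p ∈ P, z p ∈ P) →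
      P = ⊥ ∨ P = ⊤)
    (hSS : ∀ x ∈ S, ∀ z ∈ S', Commute x z) (hac : Commute a c) (haS : ∀ z ∈ S', Commute a z)
    (hcS : ∀ x ∈ S, Commute c x) :
    (∀ x ∈ S, Commute a x) ∨ ∀ z ∈ S', Commute c z := by
  -- Bracketing `a² + 2ac + c² = -1` with `x` removes `c²`. In the resulting relation `[a², x]` and
  -- `[a, x]` commute with `z`, so bracketing with `z` leaves only `2[a, x][c, z]`.
  have key : ∀ x ∈ S, ∀ z ∈ S', (a * x - x * a) * (c * z - z * c) = 0 := by
    intro x hx z hz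
    have h1 : a * a + (2 : K) • (a * c) + c * c = -1 := by
      rw [← hsq, two_smul]
      simp only [add_mul, mul_add, hac.eq]
      abel
    have h2 : (a * a * x - x * (a * a)) + (2 : K) • ((a * x - x * a) * c) = 0 := by
      have e1 : (a * a + (2 : K) • (a * c) + c * c) * x =
          x * (a * a + (2 : K) • (a * c) + c * c) := by rw [h1]; simp
      have e2 : c * c * x = x * (c * c) := ((hcS x hx).mul_left (hcS x hx)).eq
      have e3 : a * c * x = a * x * c := by rw [mul_assoc, (hcS x hx).eq, mul_assoc]
      rw [add_mul, add_mul, mul_add, mul_add, e2, add_left_inj, smul_mul_assoc, mul_smul_comm,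
        e3, ← mul_assoc x a c] at e1
      rw [sub_mul, smul_sub]
      rw [← sub_eq_zero] at e1
      rw [← e1]; abel
    have cz : Commute (a * x - x * a) z :=
      (((haS z hz).mul_left (hSS x hx z hz)).sub_left ((hSS x hx z hz).mul_left (haS z hz)))
    have cz2 : Commute (a * a * x - x * (a * a)) z :=
      (((haS z hz).mul_left (haS z hz)).mul_left (hSS x hx z hz)).sub_left
        ((hSS x hx z hz).mul_left ((haS z hz).mul_left (haS z hz)))
    have h3 : Commute ((2 : K) • ((a * x - x * a) * c)) z := by
      rw [eq_neg_of_add_eq_zero_right h2]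
      exact cz2.neg_left
    have h4 : (2 : K) • ((a * x - x * a) * c * z - z * ((a * x - x * a) * c)) = 0 := by
      have := sub_eq_zero.2 h3.eq
      rwa [smul_mul_assoc, mul_smul_comm, ← smul_sub] at this
    rw [smul_eq_zero] at h4
    have h5 := h4.resolve_left two_ne_zero
    rw [← mul_assoc z, ← cz.eq] at h5
    rw [mul_sub, ← mul_assoc, ← mul_assoc, h5]
  -- `P` is the common kernel of all `y` that centralize `S'` and annihilate every `[c, z]` from the
  -- left. It contains the images of the `[c, z]`, while `key` puts each `[a, x]` among the `y`.
  let P : Submodule K V :=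
    { carrier := {v | ∀ y : Module.End K V, (∀ z ∈ S', Commute y z ∧ y * (c * z - z * c) = 0) →
        y v = 0}
      zero_mem' := fun y _ => map_zero y
      add_mem' := fun {u v} hu hv y hy => by rw [map_add, hu y hy, hv y hy, add_zero]
      smul_mem' := fun r v hv y hy => by rw [map_smul, hv y hy, smul_zero] }
  have hP : ∀ x ∈ S, ∀ v ∈ P, x v ∈ P := by
    intro x hx v hv y hy
    refine hv (y * x) fun z hz => ⟨(hy z hz).1.mul_left (hSS x hx z hz), ?_⟩
    have cx : Commute x (c * z - z * c) :=
      ((hcS x hx).symm.mul_right (hSS x hx z hz)).sub_right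
        ((hSS x hx z hz).mul_right (hcS x hx).symm)
    rw [mul_assoc, cx.eq, ← mul_assoc, (hy z hz).2, zero_mul]
  have hP' : ∀ z ∈ S', ∀ v ∈ P, z v ∈ P := by
    intro z hz v hv y hy
    have : y (z v) = z (y v) := congr($((hy z hz).1.eq) v)
    rw [this, hv y hy, map_zero]
  rcases hirr P hP hP' with h | h
  · right
    intro z hz
    rw [commute_iff_eq, ← sub_eq_zero]
    ext v
    have : (c * z - z * c) v ∈ P := fun y hy => congr($((hy z hz).2) v)
    rw [h] at this
    simpa using this
  · left
    intro x hx
    rw [commute_iff_eq, ← sub_eq_zero]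
    ext v
    have hv : v ∈ P := h ▸ Submodule.mem_top
    exact hv _ fun z hz => ⟨((haS z hz).mul_left (hSS x hx z hz)).sub_left
      ((hSS x hx z hz).mul_left (haS z hz)), key x hx z hz⟩

end Linear

/-! ### Semisimplicity and simplicity of a linear Lie algebra -/

section LieCore

variable {W : Type*} [AddCommGroup W] [Module ℚ W] [FiniteDimensional ℚ W] [Nontrivial W]

/-- Over an algebraically closed field, a faithful irreducible traceless representation forces a
trivial radical. The scalar commutant lets irreducibility pass to the algebraic closure, and the
conclusion descends because abelian ideals stay abelian under base change. -/
theorem LieSubalgebra.hasTrivialRadical_of_irreducible_of_commutant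
    (L : LieSubalgebra ℚ (Module.End ℚ W))
    (hirr : ∀ U : Submodule ℚ W, (∀ x ∈ L, ∀ u ∈ U, x u ∈ U) → U = ⊥ ∨ U = ⊤)
    (hcomm : ∀ X : Module.End ℚ W, (∀ x ∈ L, Commute X x) → ∃ c : ℚ, X = c • 1)
    (htr : ∀ x ∈ L, LinearMap.trace ℚ W x = 0) : LieAlgebra.HasTrivialRadical ℚ L := by
  let K := AlgebraicClosure ℚ
  have hact : ∀ x : L, LieModule.toEnd K (K ⊗[ℚ] L) (K ⊗[ℚ] W) (1 ⊗ₜ x) =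
      (x : Module.End ℚ W).baseChange K := fun x => LieModule.toEnd_baseChange ..
  have h1 : LieModule.IsIrreducible K (K ⊗[ℚ] L) (K ⊗[ℚ] W) := by
    have : Nontrivial (K ⊗[ℚ] W) := inferInstance
    refine LieModule.IsIrreducible.mk fun N hN => ?_
    have := Submodule.eq_bot_or_eq_top_of_baseChange_stable (K := K) (L : Set (Module.End ℚ W))
      hirr hcomm N.toSubmodule (fun x hx p hp => by
        have := N.lie_mem (x := (1 : K) ⊗ₜ[ℚ] (⟨x, hx⟩ : L)) hp
        rwa [← LieModule.toEnd_apply_apply K, hact] at this)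
    rcases this with h | h
    · exact absurd (by simpa using h) hN
    · simpa using h
  have h2 : LieModule.IsFaithful K (K ⊗[ℚ] L) (K ⊗[ℚ] W) := by
    constructor
    -- Faithfulness: the action is the base change of the inclusion of `L`, injective by flatness,
    -- followed by the injection of `K ⊗ End(W)` into `End(K ⊗ W)`.
    have e : ∀ x, LieModule.toEnd K (K ⊗[ℚ] L) (K ⊗[ℚ] W) x =
        LinearMap.tensorProductEnd ℚ K W (L.toSubmodule.subtype.baseChange K x) := by
      intro x
      induction x using TensorProduct.induction_on with
      | zero => simp
      | tmul r x =>
        have h : LinearMap.tensorProductEnd ℚ K W (r ⊗ₜ (x : Module.End ℚ W)) =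
          r • (x : Module.End ℚ W).baseChange K := rfl
        rw [LinearMap.baseChange_tmul]
        refine Eq.trans ?_ h.symm
        rw [← hact, ← map_smul, TensorProduct.smul_tmul', smul_eq_mul, mul_one]
      | add x y hx hy => simp only [map_add, hx, hy]
    have h : Function.Injective (LinearMap.tensorProductEnd ℚ K W) := by
      have : Module.FinitePresentation ℚ W := Module.finitePresentation_of_finite ℚ W
      have h := Module.FinitePresentation.isBaseChange_map ℚ W W K
      convert! h.equiv.injective using 1
    intro x y hxy
    rw [e, e] at hxy
    exact Module.Flat.lTensor_preserves_injective_linearMap (M := K) L.toSubmodule.subtype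
      L.toSubmodule.injective_subtype (h hxy)
  have h3 : LieAlgebra.HasTrivialRadical K (K ⊗[ℚ] L) := by
    refine LieAlgebra.hasTrivialRadical_of_isIrreducible_of_isFaithful K _ (K ⊗[ℚ] W) fun x => ?_
    induction x using TensorProduct.induction_on with
    | zero => simp
    | tmul r x =>
      have : r ⊗ₜ[ℚ] x = r • ((1 : K) ⊗ₜ[ℚ] x) := by simp [TensorProduct.smul_tmul']
      rw [this, map_smul, map_smul, hact, LinearMap.trace_baseChange, htr _ x.2]
      simp
    | add x y hx hy => rw [map_add, map_add, hx, hy, add_zero]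
  rw [LieAlgebra.hasTrivialRadical_iff_no_abelian_ideals] at h3 ⊢
  intro I hI
  have hb : I.baseChange K = ⊥ := by
    refine h3 _ ?_
    rw [LieSubmodule.lie_abelian_iff_lie_self_eq_bot] at hI ⊢
    rw [← LieSubmodule.lie_baseChange, hI, LieSubmodule.baseChange_bot]
  rw [LieSubmodule.eq_bot_iff]
  intro x hx
  have : (1 : K) ⊗ₜ[ℚ] x ∈ I.baseChange K := LieSubmodule.tmul_mem_baseChange_of_mem 1 hx
  rw [hb, LieSubmodule.mem_bot] at this
  exact (Module.FaithfullyFlat.tensorProduct_mk_injective (A := ℚ) (B := K) L)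
    (by simpa using this)

/-- The commutant condition on `J` serves twice. As `J` lies in the real span of `L`, it bounds the
commutant of `L`; and it kills any element of `L` commuting with `J`, which is a traceless scalar.
-/
theorem LieSubalgebra.isSimple_of_sq_eq_neg_one
    (L : LieSubalgebra ℚ (Module.End ℚ W))
    (hirr : ∀ U : Submodule ℚ W, (∀ x ∈ L, ∀ u ∈ U, x u ∈ U) → U = ⊥ ∨ U = ⊤)
    (htr : ∀ x ∈ L, LinearMap.trace ℚ W x = 0)
    (J : Module.End ℝ (ℝ ⊗[ℚ] W)) (hJ : J * J = -1)
    (hJL : J ∈ Submodule.span ℝ ((fun x : Module.End ℚ W => x.baseChange ℝ) '' L))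
    (hcomm : ∀ X : Module.End ℚ W, Commute J (X.baseChange ℝ) → ∃ c : ℚ, X = c • 1) :
    LieAlgebra.IsSimple ℚ L := by
  have hspan : ∀ (S : Set (Module.End ℚ W)) (a y : Module.End ℝ (ℝ ⊗[ℚ] W)),
      a ∈ Submodule.span ℝ ((fun x : Module.End ℚ W => x.baseChange ℝ) '' S) →
      (∀ x ∈ S, Commute (x.baseChange ℝ) y) → Commute a y := by
    intro S a y ha h
    induction ha using Submodule.span_induction with
    | mem x hx => obtain ⟨x, hx, rfl⟩ := hx; exact h x hx
    | zero => exact Commute.zero_left _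
    | add x z _ _ hx hz => exact hx.add_left hz
    | smul r x _ hx => exact hx.smul_left r
  have hbc : ∀ x y : Module.End ℚ W, Commute x y → Commute (x.baseChange ℝ) (y.baseChange ℝ) := by
    intro x y h
    rw [commute_iff_eq, ← LinearMap.baseChange_mul, h.eq, LinearMap.baseChange_mul]
  have hcomm' : ∀ X : Module.End ℚ W, (∀ x ∈ L, Commute X x) → ∃ c : ℚ, X = c • 1 :=
    fun X hX => hcomm X (hspan _ _ _ hJL fun x hx => (hbc _ _ (hX x hx)).symm)
  have hzero : ∀ x ∈ L, Commute J (x.baseChange ℝ) → x = 0 := by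
    intro x hx h
    obtain ⟨c, rfl⟩ := hcomm x h
    have := htr _ hx
    rw [map_smul, LinearMap.trace_one, smul_eq_mul, mul_eq_zero] at this
    rcases this with h | h
    · rw [h, zero_smul]
    · exact absurd h (by exact_mod_cast Module.finrank_pos.ne')
  have := L.hasTrivialRadical_of_irreducible_of_commutant hirr hcomm' htr
  have hL0 : ∃ x ∈ L, x ≠ 0 := by
    by_contra! h
    have h0 : J = 0 := by
      have := Submodule.span_mono (R := ℝ) (s := (fun x : Module.End ℚ W => x.baseChange ℝ) '' L)
        (t := {0}) (by rintro _ ⟨x, hx, rfl⟩; simp [h x hx]) hJL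
      simpa using this
    have : Nontrivial (ℝ ⊗[ℚ] W) := inferInstance
    rw [h0, zero_mul] at hJ
    exact one_ne_zero (neg_eq_zero.1 hJ.symm)
  refine ⟨fun I => ?_, fun hab => ?_⟩
  -- Semisimplicity makes the Killing orthogonal a complementary ideal; it commutes with `I` since
  -- brackets land in `I ⊓ I'`.
  · let I' := LieIdeal.killingCompl ℚ L I
    have hc : IsCompl I I' := I.isCompl_killingCompl
    have hII : ∀ x ∈ I, ∀ z ∈ I', Commute (x : Module.End ℚ W) (z : Module.End ℚ W) := by
      intro x hx z hz
      have h : ⁅x, z⁆ ∈ I ⊓ I' :=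
        ⟨lie_mem_left _ _ I x z hx, lie_mem_right _ _ I' x z hz⟩
      rw [hc.inf_eq_bot, LieSubmodule.mem_bot] at h
      have h2 : (x : Module.End ℚ W) * z - z * x = 0 := congr(($h : Module.End ℚ W))
      exact sub_eq_zero.1 h2
    let T : LieIdeal ℚ L → Set (Module.End ℚ W) := fun I => Subtype.val '' (I : Set L)
    have hdec : J ∈ Submodule.span ℝ ((fun x : Module.End ℚ W => x.baseChange ℝ) '' T I) ⊔
        Submodule.span ℝ ((fun x : Module.End ℚ W => x.baseChange ℝ) '' T I') := by
      refine Submodule.span_le.2 ?_ hJL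
      rintro _ ⟨x, hx, rfl⟩
      have hx' : (⟨x, hx⟩ : L) ∈ I ⊔ I' := by rw [hc.sup_eq_top]; trivial
      obtain ⟨y, hy, z, hz, hyz⟩ := (LieSubmodule.mem_sup _ _ _).1 hx'
      have : x = y + z := congr(($hyz.symm : Module.End ℚ W))
      simp only [SetLike.mem_coe]
      rw [this, LinearMap.baseChange_add]
      exact Submodule.add_mem_sup (Submodule.subset_span ⟨y, ⟨y, hy, rfl⟩, rfl⟩)
        (Submodule.subset_span ⟨z, ⟨z, hz, rfl⟩, rfl⟩)
    obtain ⟨a, ha, c, hc', hJac⟩ := Submodule.mem_sup.1 hdec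
    have haS : ∀ z ∈ I', Commute a ((z : Module.End ℚ W).baseChange ℝ) := fun z hz =>
      hspan _ _ _ ha (by rintro _ ⟨x, hx, rfl⟩; exact hbc _ _ (hII x hx z hz))
    have hcS : ∀ x ∈ I, Commute c ((x : Module.End ℚ W).baseChange ℝ) := fun x hx =>
      hspan _ _ _ hc' (by rintro _ ⟨z, hz, rfl⟩; exact (hbc _ _ (hII x hx z hz)).symm)
    have hac : Commute a c :=
      hspan _ _ _ ha (by rintro _ ⟨x, hx, rfl⟩; exact (hcS x hx).symm)
    rcases commute_or_commute_of_sq_eq_neg_one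
      ((fun x : Module.End ℚ W => x.baseChange ℝ) '' T I)
      ((fun x : Module.End ℚ W => x.baseChange ℝ) '' T I') a c (by rw [hJac, hJ])
      (fun P h1 h2 => Submodule.eq_bot_or_eq_top_of_baseChange_stable
        (L : Set (Module.End ℚ W)) hirr hcomm' P fun x hx p hp => by
          have hx' : (⟨x, hx⟩ : L) ∈ I ⊔ I' := by rw [hc.sup_eq_top]; trivial
          obtain ⟨y, hy, z, hz, hyz⟩ := (LieSubmodule.mem_sup _ _ _).1 hx'
          have : x = y + z := congr(($hyz.symm : Module.End ℚ W))
          rw [this, LinearMap.baseChange_add]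
          exact P.add_mem (h1 _ ⟨y, ⟨y, hy, rfl⟩, rfl⟩ p hp) (h2 _ ⟨z, ⟨z, hz, rfl⟩, rfl⟩ p hp))
      (by
        rintro _ ⟨_, ⟨x, hx, rfl⟩, rfl⟩ _ ⟨_, ⟨z, hz, rfl⟩, rfl⟩
        exact hbc _ _ (hII x hx z hz)) hac
      (by rintro _ ⟨_, ⟨z, hz, rfl⟩, rfl⟩; exact haS z hz)
      (by rintro _ ⟨_, ⟨x, hx, rfl⟩, rfl⟩; exact hcS x hx) with h | h
    · left
      rw [LieSubmodule.eq_bot_iff]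
      intro x hx
      refine Subtype.ext (hzero x x.2 ?_)
      rw [← hJac]
      exact (h _ ⟨x, ⟨x, hx, rfl⟩, rfl⟩).add_left (hcS x hx)
    · right
      have : I' = ⊥ := by
        rw [LieSubmodule.eq_bot_iff]
        intro z hz
        refine Subtype.ext (hzero z z.2 ?_)
        rw [← hJac]
        exact (haS z hz).add_left (h _ ⟨z, ⟨z, hz, rfl⟩, rfl⟩)
      have h2 := hc.sup_eq_top
      rwa [this, sup_bot_eq] at h2
  -- If `L` were abelian, all of it would commute with `J` and hence vanish, whereas `J ≠ 0`.
  · obtain ⟨x, hx, hx0⟩ := hL0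
    refine hx0 (hzero x hx (hspan _ _ _ hJL fun y hy => hbc _ _ ?_))
    have h2 : y * x - x * y = 0 := congr(($(hab.trivial ⟨y, hy⟩ ⟨x, hx⟩) : Module.End ℚ W))
    exact sub_eq_zero.1 h2

end LieCore

/-! ### Tangent vectors of algebraic subgroups -/

section AlgebraicGroupLie

universe u

variable {W : Type u} [AddCommGroup W] [Module ℚ W]

theorem endCoord_add {R : Type} [CommRing R] [Algebra ℚ R] (x y : R ⊗[ℚ] Module.End ℚ W)
    (l : Module.Dual ℚ (Module.End ℚ W)) :
    endCoord R (x + y) l = endCoord R x l + endCoord R y l := by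
  simp [endCoord]

theorem endCoord_smul {R : Type} [CommRing R] [Algebra ℚ R] (r : R) (x : R ⊗[ℚ] Module.End ℚ W)
    (l : Module.Dual ℚ (Module.End ℚ W)) : endCoord R (r • x) l = r * endCoord R x l := by
  induction x using TensorProduct.induction_on with
  | zero => simp [endCoord]
  | tmul s u => simp [endCoord, TensorProduct.smul_tmul']
  | add x y hx hy => rw [smul_add, endCoord_add, endCoord_add, hx, hy, mul_add]

theorem endCoord_tmul {R : Type} [CommRing R] [Algebra ℚ R] (r : R) (u : Module.End ℚ W)
    (l : Module.Dual ℚ (Module.End ℚ W)) : endCoord R (r ⊗ₜ u) l = l u • r := by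
  simp [endCoord]

theorem endCoord_one {R : Type} [CommRing R] [Algebra ℚ R]
    (l : Module.Dual ℚ (Module.End ℚ W)) : endCoord R 1 l = algebraMap ℚ R (l 1) := by
  rw [Algebra.TensorProduct.one_def, endCoord_tmul, Algebra.algebraMap_eq_smul_one]

/-- The differential at `1` of a polynomial function on `End_ℚ(W)` computes both its values on
`1 + εX` and the derivatives at `0` of its restrictions to the curves
`t ↦ cos t + sin t J`. -/
theorem exists_differential_evalPoly (p : MvPolynomial (Module.Dual ℚ (Module.End ℚ W)) ℚ) :
    ∃ d : Module.Dual ℚ (Module.End ℚ W),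
      (∀ X, evalPoly (DualNumber ℚ) (oneAddEps X : DualNumber ℚ ⊗[ℚ] Module.End ℚ W) p =
        TrivSqZeroExt.inl (MvPolynomial.aeval (fun l => l 1) p) + TrivSqZeroExt.inr (d X)) ∧
      evalPoly ℝ (1 : ℝ ⊗[ℚ] Module.End ℚ W) p =
        (MvPolynomial.aeval (fun l => l 1) p : ℚ) ∧
      ∀ J : ℝ ⊗[ℚ] Module.End ℚ W,
        HasDerivAt (fun t => evalPoly ℝ (Real.cos t • 1 + Real.sin t • J) p)
          (endCoord ℝ J d) 0 := by
  have hX : ∀ X : Module.End ℚ W, ∀ l,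
      endCoord (DualNumber ℚ) (oneAddEps X : DualNumber ℚ ⊗[ℚ] Module.End ℚ W) l =
        TrivSqZeroExt.inl (l 1) + TrivSqZeroExt.inr (l X) := by
    intro X l
    change endCoord _ (1 + DualNumber.eps ⊗ₜ X) l = _
    rw [endCoord_add, endCoord_one, endCoord_tmul]
    ext <;> simp [TrivSqZeroExt.algebraMap_eq_inl']
  induction p using MvPolynomial.induction_on with
  | C a =>
    refine ⟨0, fun X => ?_, ?_, fun J => ?_⟩
    · ext <;> simp [evalPoly, TrivSqZeroExt.algebraMap_eq_inl']
    · simp [evalPoly]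
    · simpa [evalPoly, endCoord] using hasDerivAt_const (0 : ℝ) (a : ℝ)
  | add p q hp hq =>
    obtain ⟨d, h1, h2, h3⟩ := hp
    obtain ⟨e, g1, g2, g3⟩ := hq
    refine ⟨d + e, fun X => ?_, ?_, fun J => ?_⟩
    · have := congr($(h1 X) + $(g1 X))
      rw [evalPoly, map_add]
      refine this.trans ?_
      ext <;> simp
    · have := congr($h2 + $g2)
      rw [evalPoly, map_add]
      refine this.trans ?_
      simp
    · have hv : endCoord ℝ J (d + e) = endCoord ℝ J d + endCoord ℝ J e := by
        simp [endCoord, LinearMap.lTensor_add]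
      rw [hv]
      refine ((h3 J).fun_add (g3 J)).congr_of_eventuallyEq (.of_forall fun t => ?_)
      simp [evalPoly]
  | mul_X p l hp =>
    obtain ⟨d, h1, h2, h3⟩ := hp
    -- Leibniz rule at the identity: `d(pl) = p(1) l + l(1) dp`.
    refine ⟨(MvPolynomial.aeval (fun l => l 1) p : ℚ) • l + (l 1) • d,
      fun X => ?_, ?_, fun J => ?_⟩
    · have := congr($(h1 X) * $(hX X l))
      rw [evalPoly, map_mul, MvPolynomial.aeval_X]
      refine this.trans ?_
      ext
      · simp
      · simp; ring
    · have := congr($h2 * $(endCoord_one (R := ℝ) l))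
      rw [evalPoly, map_mul, MvPolynomial.aeval_X]
      refine this.trans ?_
      simp
    · have hl : HasDerivAt (fun t => endCoord ℝ (Real.cos t • 1 + Real.sin t • J) l)
          (endCoord ℝ J l) 0 := by
        simp only [endCoord_add, endCoord_smul, endCoord_one]
        have := ((Real.hasDerivAt_cos 0).mul_const (algebraMap ℚ ℝ (l 1))).fun_add
          ((Real.hasDerivAt_sin 0).mul_const (endCoord ℝ J l))
        simpa using this
      have := (h3 J).fun_mul hl
      simp only [Real.cos_zero, Real.sin_zero, one_smul, zero_smul, add_zero, h2,
        endCoord_one] at this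
      have hv : endCoord ℝ J ((MvPolynomial.aeval (fun l => l 1) p : ℚ) • l + (l 1) • d) =
          endCoord ℝ J d * algebraMap ℚ ℝ (l 1) +
            (MvPolynomial.aeval (fun l => l 1) p : ℚ) * endCoord ℝ J l := by
        simp only [endCoord, LinearMap.lTensor_add, LinearMap.lTensor_smul, LinearMap.add_apply,
          LinearMap.smul_apply, map_add, map_smul, Algebra.smul_def, eq_ratCast]
        ring
      rw [hv]
      refine this.congr_of_eventuallyEq (.of_forall fun t => ?_)
      simp [evalPoly]

/-- Write `J = ∑ bᵢ ⊗ cᵢ` with `b` a `ℚ`-basis of `ℝ`. Each equation of `G` has a rational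
differential `d` at `1`, and differentiating along the circle gives `∑ d(cᵢ) bᵢ = 0`. Independence
over `ℚ` yields `d(cᵢ) = 0`, so every `cᵢ` is tangent to `G`. -/
theorem AlgSubgroupGL.mem_span_lie_of_circle (G : AlgSubgroupGL W) (J : ℝ ⊗[ℚ] Module.End ℚ W)
    (hJ : ∀ t : ℝ, ∃ g ∈ G.points ℝ,
      (g : ℝ ⊗[ℚ] Module.End ℚ W) = Real.cos t • 1 + Real.sin t • J) :
    J ∈ Submodule.span ℝ ((fun X : Module.End ℚ W => (1 : ℝ) ⊗ₜ[ℚ] X) '' G.lie) := by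
  obtain ⟨S, hS⟩ := G.closed
  let b := Module.Basis.ofVectorSpace ℚ ℝ
  obtain ⟨c, hc⟩ := TensorProduct.eq_repr_basis_left b J
  have hmem : ∀ i, c i ∈ G.lie := by
    intro i
    change oneAddEps (c i) ∈ G.points _
    rw [hS]
    intro p hp
    obtain ⟨d, h1, h2, h3⟩ := exists_differential_evalPoly p
    have hz : ∀ t : ℝ, evalPoly ℝ (Real.cos t • 1 + Real.sin t • J) p = 0 := by
      intro t
      obtain ⟨g, hg, hgt⟩ := hJ t
      rw [← hgt]
      exact (hS ℝ g).1 hg p hp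
    have hp1 : (MvPolynomial.aeval (fun l => l 1) p : ℚ) = 0 := by
      have := hz 0
      simp only [Real.cos_zero, Real.sin_zero, one_smul, zero_smul, add_zero, h2] at this
      exact_mod_cast this
    have hd : endCoord ℝ J d = 0 := by
      have := h3 J
      simp only [hz] at this
      exact this.unique (hasDerivAt_const _ _)
    have hd' : Finsupp.linearCombination ℚ b (c.mapRange d (map_zero d)) = 0 := by
      rw [← hd, ← hc, Finsupp.linearCombination_apply, Finsupp.sum_mapRange_index (by simp)]
      simp only [endCoord, Finsupp.sum, map_sum, LinearMap.lTensor_tmul, TensorProduct.rid_tmul]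
    have hdi := congr($((linearIndependent_iff.1 b.linearIndependent) _ hd') i)
    rw [Finsupp.mapRange_apply, Finsupp.zero_apply] at hdi
    rw [h1, hp1, hdi]
    simp
  rw [← hc]
  refine Submodule.sum_mem _ fun i _ => ?_
  have : b i ⊗ₜ[ℚ] c i = b i • ((1 : ℝ) ⊗ₜ[ℚ] c i) := by simp [TensorProduct.smul_tmul']
  change b i ⊗ₜ[ℚ] c i ∈ _
  rw [this]
  exact Submodule.smul_mem _ _ (Submodule.subset_span ⟨_, hmem i, rfl⟩)

/-! ### The special linear group and the trace -/

section SpecialLinear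

/-- Matrix entries are coordinates along rational functionals, which makes the determinant a
polynomial function with rational coefficients. -/
theorem toMatrix_tensorProductEnd {n : Type*} [Fintype n] [DecidableEq n] (b : Module.Basis n ℚ W)
    (R : Type) [CommRing R] [Algebra ℚ R] (x : R ⊗[ℚ] Module.End ℚ W) (i j : n) :
    LinearMap.toMatrix (b.baseChange R) (b.baseChange R) (LinearMap.tensorProductEnd ℚ R W x) i j =
      endCoord R x (Matrix.entryLinearMap ℚ ℚ i j ∘ₗ (LinearMap.toMatrix b b).toLinearMap) := by
  induction x using TensorProduct.induction_on with
  | zero => simp [endCoord]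
  | tmul r u =>
    have h : LinearMap.tensorProductEnd ℚ R W (r ⊗ₜ u) = r • u.baseChange R := rfl
    rw [h, endCoord_tmul, map_smul, Matrix.smul_apply, LinearMap.toMatrix_apply]
    simp [LinearMap.toMatrix_apply, Algebra.smul_def, mul_comm]
  | add x y hx hy => rw [map_add, map_add, Matrix.add_apply, hx, hy, endCoord_add]

theorem tensorProductEnd_one_add_tmul {R : Type} [CommRing R] [Algebra ℚ R] (r : R)
    (X : Module.End ℚ W) :
    LinearMap.tensorProductEnd ℚ R W (1 + r ⊗ₜ X) = 1 + r • X.baseChange R := by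
  have h : LinearMap.tensorProductEnd ℚ R W 1 = 1 := (LinearMap.tensorProductEnd ℚ R W).map_one'
  rw [map_add, h]
  rfl

variable [FiniteDimensional ℚ W]

/-- The algebraic group `SL(W)`. -/
noncomputable def AlgSubgroupGL.specialLinear (W : Type u) [AddCommGroup W] [Module ℚ W]
    [FiniteDimensional ℚ W] : AlgSubgroupGL W where
  points R _ _ := (((LinearMap.det : Module.End R (R ⊗[ℚ] W) →* R).comp
    (LinearMap.tensorProductEnd ℚ R W : _ →* _)).comp (Units.coeHom _)).ker
  closed := by
    let b := Module.finBasis ℚ W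
    refine ⟨{Matrix.det (Matrix.of fun i j => MvPolynomial.X (Matrix.entryLinearMap ℚ ℚ i j ∘ₗ
      (LinearMap.toMatrix b b).toLinearMap)) - 1}, fun R _ _ g => ?_⟩
    have h : LinearMap.det (LinearMap.tensorProductEnd ℚ R W g) - 1 =
        evalPoly R g (Matrix.det (Matrix.of fun i j => MvPolynomial.X
          (Matrix.entryLinearMap ℚ ℚ i j ∘ₗ (LinearMap.toMatrix b b).toLinearMap)) - 1) := by
      rw [← LinearMap.det_toMatrix (b.baseChange R), evalPoly, map_sub, map_one, AlgHom.map_det]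
      congr 2
      ext i j
      refine (toMatrix_tensorProductEnd b R g i j).trans ?_
      simp
    simp only [Set.mem_singleton_iff, forall_eq]
    rw [← h, sub_eq_zero]
    rfl

theorem AlgSubgroupGL.mem_points_specialLinear {R : Type} [CommRing R] [Algebra ℚ R]
    (g : GLPoints W R) : g ∈ (AlgSubgroupGL.specialLinear W).points R ↔
      LinearMap.det (LinearMap.tensorProductEnd ℚ R W g) = 1 := Iff.rfl

/-- Since `ε² = 0`, `det(1 + εX) = 1 + ε tr X`. -/
theorem AlgSubgroupGL.trace_eq_zero_of_mem_lie_specialLinear {X : Module.End ℚ W}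
    (hX : X ∈ (AlgSubgroupGL.specialLinear W).lie) : LinearMap.trace ℚ W X = 0 := by
  let b := Module.finBasis ℚ W
  have h1 : LinearMap.det (LinearMap.tensorProductEnd ℚ (DualNumber ℚ) W
    (oneAddEps X : DualNumber ℚ ⊗[ℚ] Module.End ℚ W)) = 1 := hX
  have h2 : LinearMap.tensorProductEnd ℚ (DualNumber ℚ) W
      (oneAddEps X : DualNumber ℚ ⊗[ℚ] Module.End ℚ W) =
      1 + (DualNumber.eps : DualNumber ℚ) • X.baseChange (DualNumber ℚ) :=
    tensorProductEnd_one_add_tmul (R := DualNumber ℚ) DualNumber.eps X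
  rw [h2, ← LinearMap.det_toMatrix (b.baseChange (DualNumber ℚ)), map_add, map_smul,
    LinearMap.toMatrix_one, Matrix.det_one_add_smul, pow_two, DualNumber.eps_mul_eps, mul_zero,
    add_zero, add_eq_left, ← LinearMap.trace_eq_matrix_trace, LinearMap.trace_baseChange] at h1
  have h3 := congr(TrivSqZeroExt.snd $h1)
  simpa [TrivSqZeroExt.algebraMap_eq_inl'] using h3

end SpecialLinear

theorem AlgSubgroupGL.lie_mono {G H : AlgSubgroupGL W} (h : G ≤ H) : G.lie ≤ H.lie :=
  fun _ hX => h (DualNumber ℚ) hX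

end AlgebraicGroupLie

/-! ### Clearing denominators in `ℚ ⊗ A` -/

section ClearDenominators

theorem exists_zsmul_eq_one_tmul {A : Type*} [AddCommGroup A] (w : ℚ ⊗[ℤ] A) :
    ∃ n : ℤ, n ≠ 0 ∧ ∃ x : A, n • w = 1 ⊗ₜ x := by
  induction w using TensorProduct.induction_on with
  | zero => exact ⟨1, one_ne_zero, 0, by simp⟩
  | tmul q x =>
    refine ⟨q.den, by exact_mod_cast q.den_ne_zero, q.num • x, ?_⟩
    rw [TensorProduct.tmul_smul, TensorProduct.smul_tmul', TensorProduct.smul_tmul']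
    congr 1
    simp [Rat.den_mul_eq_num]
  | add w w' h h' =>
    obtain ⟨n, hn, x, hx⟩ := h
    obtain ⟨m, hm, y, hy⟩ := h'
    refine ⟨n * m, mul_ne_zero hn hm, m • x + n • y, ?_⟩
    rw [TensorProduct.tmul_add, TensorProduct.tmul_smul, TensorProduct.tmul_smul, ← hx, ← hy,
      smul_add, mul_smul, mul_smul, smul_comm n m w]

/-- The product of denominators for the images of a finite basis works uniformly. -/
theorem exists_zsmul_map_one_tmul_eq {A : Type*} [AddCommGroup A] [Module.Free ℤ A]
    [Module.Finite ℤ A] (X : Module.End ℚ (ℚ ⊗[ℤ] A)) :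
    ∃ n : ℤ, n ≠ 0 ∧ ∀ x : A, ∃ y : A, n • X (1 ⊗ₜ x) = 1 ⊗ₜ y := by
  let b := Module.Free.chooseBasis ℤ A
  choose n hn y hy using fun i => exists_zsmul_eq_one_tmul (X (1 ⊗ₜ b i))
  refine ⟨∏ i, n i, Finset.prod_ne_zero_iff.2 fun i _ => hn i, fun x => ?_⟩
  have hx : x ∈ Submodule.span ℤ (Set.range b) := by rw [b.span_eq]; trivial
  induction hx using Submodule.span_induction with
  | mem x hx =>
    obtain ⟨i, rfl⟩ := hx
    obtain ⟨m, hm⟩ := Finset.dvd_prod_of_mem n (Finset.mem_univ i)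
    exact ⟨m • y i, by rw [hm, mul_comm, mul_smul, hy, TensorProduct.tmul_smul]⟩
  | zero => exact ⟨0, by simp⟩
  | add x z _ _ hx hz =>
    obtain ⟨y, hy⟩ := hx
    obtain ⟨y', hy'⟩ := hz
    exact ⟨y + y', by rw [TensorProduct.tmul_add, map_add, smul_add, hy, hy',
      TensorProduct.tmul_add]⟩
  | smul r x _ hx =>
    obtain ⟨y, hy⟩ := hx
    exact ⟨r • y, by rw [TensorProduct.tmul_smul, map_zsmul, smul_comm, hy,
      TensorProduct.tmul_smul]⟩

end ClearDenominators

/-! ### The Hodge Lie algebra of a complex torus -/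

namespace ComplexTorus

universe v

variable {V : Type v} [NormedAddCommGroup V] [NormedSpace ℂ V]

/-- A continuous map from the connected line to a discrete space is constant; compare `t = 1` and `t
= 0`. -/
theorem eq_zero_of_forall_smul_mem (Λ : Submodule ℤ V) [DiscreteTopology Λ] (w : V)
    (hw : ∀ t : ℝ, t • w ∈ Λ) : w = 0 := by
  have hc : Continuous fun t : ℝ => (⟨t • w, hw t⟩ : Λ) :=
    Continuous.subtype_mk (by fun_prop) _
  have := PreconnectedSpace.constant inferInstance hc (x := 1) (y := 0)
  simpa using congrArg Subtype.val this

/-- If `End⁰(T) = ℚ`, then every complex linear endomorphism of `V` preserving `Λ` is a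
rational homothety. -/
theorem exists_zsmul_eq_of_map_mem [FiniteDimensional ℂ V]
    (Λ : Submodule ℤ V) [DiscreteTopology Λ] (hend : EndAlgebraEqRat Λ)
    (G : V →ₗ[ℂ] V) (hG : ∀ x ∈ Λ, G x ∈ Λ) : ∃ m a : ℤ, m ≠ 0 ∧ ∀ v, m • G v = a • v := by
  let g : V →ₗ[ℤ] V := G.restrictScalars ℤ
  let f : AddMonoid.End (V ⧸ Λ) := (Λ.mapQ Λ g hG).toAddMonoidHom
  have hf : f ∈ endRing Λ := fun x =>
    ⟨G, (LinearMap.toContinuousLinearMap G).analyticAt x, .of_forall fun y => rfl⟩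
  obtain ⟨q, hq⟩ := hend.2 (1 ⊗ₜ ⟨f, hf⟩)
  have hq' : q ⊗ₜ[ℤ] (1 : endRing Λ) = 1 ⊗ₜ[ℤ] (⟨f, hf⟩ : endRing Λ) := hq
  -- With `q` cleared of its denominator, `den q · f - num q` dies in `ℚ ⊗ End(T)`, so some nonzero
  -- integer `m` kills it in `End(T)`.
  have h0 : TensorProduct.mk ℤ ℚ (endRing Λ) 1
      ((q.den : ℤ) • (⟨f, hf⟩ : endRing Λ) - q.num • 1) = 0 := by
    rw [map_sub, map_zsmul, map_zsmul, TensorProduct.mk_apply, TensorProduct.mk_apply, ← hq',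
      TensorProduct.smul_tmul', TensorProduct.smul_tmul', sub_eq_zero]
    congr 1
    simp [Rat.den_mul_eq_num]
  have : IsLocalizedModule (nonZeroDivisors ℤ) (TensorProduct.mk ℤ ℚ (endRing Λ) 1) :=
    (isLocalizedModule_iff_isBaseChange (nonZeroDivisors ℤ) ℚ _).2
      (TensorProduct.isBaseChange ℤ (endRing Λ) ℚ)
  obtain ⟨m, hm⟩ := (IsLocalizedModule.eq_zero_iff (nonZeroDivisors ℤ) _).1 h0
  have hm0 : (m : ℤ) ≠ 0 := nonZeroDivisors.ne_zero m.2
  refine ⟨m * q.den, m * q.num, mul_ne_zero hm0 (by exact_mod_cast q.den_ne_zero), fun v => ?_⟩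
  rw [← sub_eq_zero]
  -- An identity in `V / Λ` only gives membership in `Λ`; applied to every `t • v` it places a whole
  -- real line in the discrete group `Λ`.
  refine eq_zero_of_forall_smul_mem Λ _ fun t => ?_
  have h1 : (m : ℤ) • ((q.den : ℤ) • f - q.num • 1) = 0 := congrArg Subtype.val hm
  have h2 := congr($h1 (Submodule.Quotient.mk (t • v)))
  rw [← Submodule.Quotient.mk_eq_zero]
  refine Eq.trans ?_ h2
  change _ = (m : ℤ) • ((q.den : ℤ) • Submodule.Quotient.mk (p := Λ) (G (t • v)) -
    q.num • Submodule.Quotient.mk (p := Λ) (t • v))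
  rw [← Submodule.Quotient.mk_smul, ← Submodule.Quotient.mk_smul, ← Submodule.Quotient.mk_sub,
    ← Submodule.Quotient.mk_smul]
  congr 1
  have : G (t • v) = t • G v := by rw [← Complex.coe_smul, map_smul, Complex.coe_smul]
  rw [this, smul_sub, smul_sub, mul_smul, mul_smul, smul_comm t (m : ℤ), smul_comm t (m : ℤ),
    smul_comm t (q.den : ℤ), smul_comm t q.num]

variable [FiniteDimensional ℂ V] (Λ : Submodule ℤ V) [DiscreteTopology Λ] [IsZLattice ℝ Λ]

theorem realEndEquiv_realEquiv (x : ℝ ⊗[ℚ] Module.End ℚ (RatLattice Λ))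
    (p : ℝ ⊗[ℚ] RatLattice Λ) :
    realEndEquiv Λ x (realEquiv Λ p) =
      realEquiv Λ (LinearMap.tensorProductEnd ℚ ℝ (RatLattice Λ) x p) := by
  have h : realEndEquiv Λ x = (realEquiv Λ).conjAlgEquiv ℝ
      (LinearMap.tensorProductEnd ℚ ℝ (RatLattice Λ) x) := rfl
  rw [h]
  simp

theorem realEquiv_one_tmul (x : Λ) : realEquiv Λ (1 ⊗ₜ (1 ⊗ₜ x)) = x := by
  simp [realEquiv_tmul]

theorem det_tensorProductEnd (x : ℝ ⊗[ℚ] Module.End ℚ (RatLattice Λ)) :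
    LinearMap.det (LinearMap.tensorProductEnd ℚ ℝ (RatLattice Λ) x) =
      LinearMap.det (realEndEquiv Λ x) :=
  (LinearMap.det_conj _ (realEquiv Λ)).symm

/-- The complex structure of `V` as an element of `End_ℚ(Λ_ℚ) ⊗ ℝ`. -/
noncomputable def complexStructure : ℝ ⊗[ℚ] Module.End ℚ (RatLattice Λ) :=
  (realEndEquiv Λ).symm (Algebra.lsmul ℝ ℝ V Complex.I)

theorem realEndEquiv_complexStructure (v : V) :
    realEndEquiv Λ (complexStructure Λ) v = Complex.I • v := by
  simp [complexStructure]

theorem complexStructure_mul_self : complexStructure Λ * complexStructure Λ = -1 := by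
  apply (realEndEquiv Λ).injective
  ext v
  rw [map_mul, Module.End.mul_apply, realEndEquiv_complexStructure,
    realEndEquiv_complexStructure, smul_smul, Complex.I_mul_I]
  simp

theorem hodgeHom_circleExp (t : ℝ) :
    (hodgeHom Λ (Circle.toUnits (Circle.exp t)) : ℝ ⊗[ℚ] Module.End ℚ (RatLattice Λ)) =
      Real.cos t • 1 + Real.sin t • complexStructure Λ := by
  apply (realEndEquiv Λ).injective
  ext v
  rw [realEndEquiv_hodgeHom, map_add, map_smul, map_smul, map_one, LinearMap.add_apply,
    LinearMap.smul_apply, LinearMap.smul_apply, realEndEquiv_complexStructure,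
    Module.End.one_apply, ← Complex.coe_smul, ← Complex.coe_smul, smul_smul, ← add_smul]
  congr 1
  simp [Circle.coe_exp, Complex.exp_mul_I]

theorem complexStructure_mem_span : complexStructure Λ ∈ Submodule.span ℝ
    ((fun X : Module.End ℚ (RatLattice Λ) => (1 : ℝ) ⊗ₜ[ℚ] X) '' hodgeLie Λ) :=
  (hodgeGroup Λ).mem_span_lie_of_circle _ fun t =>
    ⟨_, hodgeGroup_contains Λ (Circle.exp t), hodgeHom_circleExp Λ t⟩

/-- By minimality `Hdg(T) ≤ SL(Λ_ℚ)`: the real determinant of multiplication by `z` is the norm of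
its complex determinant, a power of `|z|² = 1`. -/
theorem trace_eq_zero_of_mem_hodgeLie {X : Module.End ℚ (RatLattice Λ)} (hX : X ∈ hodgeLie Λ) :
    LinearMap.trace ℚ _ X = 0 := by
  refine AlgSubgroupGL.trace_eq_zero_of_mem_lie_specialLinear
    (AlgSubgroupGL.lie_mono (hodgeGroup_le Λ _ fun z => ?_) hX)
  rw [AlgSubgroupGL.mem_points_specialLinear, det_tensorProductEnd]
  have h : realEndEquiv Λ (hodgeHom Λ (Circle.toUnits z)) =
      ((z : ℂ) • (1 : Module.End ℂ V)).restrictScalars ℝ := by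
    ext v
    rw [realEndEquiv_hodgeHom]
    rfl
  rw [h, LinearMap.det_restrictScalars, LinearMap.det_smul, map_one, mul_one,
    Algebra.norm_complex_apply, map_pow, Circle.normSq_coe, one_pow]

/-- The real span of `U` is stable under `hdg_T ⊗ ℝ`, hence under multiplication by `i`. After
clearing denominators it is spanned by lattice vectors, so it defines a subtorus. -/
theorem hodgeLie_irreducible (hsimple : IsSimple Λ) (U : Submodule ℚ (RatLattice Λ))
    (hU : ∀ X ∈ hodgeLie Λ, ∀ u ∈ U, X u ∈ U) : U = ⊥ ∨ U = ⊤ := by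
  let U' : Submodule ℝ V := (U.baseChange ℝ).map (realEquiv Λ).toLinearMap
  have hspan : U' = Submodule.span ℝ ((fun u => realEquiv Λ (1 ⊗ₜ u)) '' (U : Set _)) := by
    simp only [U', Submodule.baseChange_eq_span, Submodule.map_span]
    congr 1
    ext v
    simp
  have hmem : ∀ u ∈ U, realEquiv Λ (1 ⊗ₜ u) ∈ U' := fun u hu => by
    rw [hspan]; exact Submodule.subset_span ⟨u, hu, rfl⟩
  have hI : ∀ v ∈ U', Complex.I • v ∈ U' := by
    simp only [← realEndEquiv_complexStructure Λ]
    have hJ := complexStructure_mem_span Λ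
    generalize complexStructure Λ = J at hJ
    induction hJ using Submodule.span_induction with
    | mem x hx =>
      obtain ⟨X, hX, rfl⟩ := hx
      intro v hv
      rw [hspan] at hv
      induction hv using Submodule.span_induction with
      | mem v hv =>
        obtain ⟨u, hu, rfl⟩ := hv
        rw [realEndEquiv_tmul, one_mul]
        exact hmem _ (hU X hX u hu)
      | zero => rw [map_zero]; exact U'.zero_mem
      | add x y _ _ hx hy => rw [map_add]; exact U'.add_mem hx hy
      | smul r x _ hx => rw [map_smul]; exact U'.smul_mem r hx
    | zero => intro v _; rw [map_zero]; exact U'.zero_mem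
    | add x y _ _ hx hy => intro v hv; rw [map_add]; exact U'.add_mem (hx v hv) (hy v hv)
    | smul r x _ hx => intro v hv; rw [map_smul]; exact U'.smul_mem r (hx v hv)
  let UC : Submodule ℂ V :=
    { U' with
      smul_mem' := fun z v hv => by
        have : z • v = z.re • v + z.im • (Complex.I • v) := by
          rw [← Complex.coe_smul, ← Complex.coe_smul, smul_smul, ← add_smul, Complex.re_add_im]
        rw [this]
        exact U'.add_mem (U'.smul_mem _ hv) (U'.smul_mem _ (hI v hv)) }
  have hUC : UC.restrictScalars ℝ = U' := rfl
  have hsub : IsSubtorus Λ UC := by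
    rw [IsSubtorus, hUC]
    refine le_antisymm (Submodule.span_le.2 fun v hv => hv.1) ?_
    rw [hspan, Submodule.span_le]
    rintro _ ⟨u, hu, rfl⟩
    obtain ⟨n, hn, x, hx⟩ := exists_zsmul_eq_one_tmul u
    have hnx : (n : ℝ) • realEquiv Λ (1 ⊗ₜ u) = x := by
      rw [← realEquiv_one_tmul Λ x, ← hx, Int.cast_smul_eq_zsmul, ← map_zsmul,
        TensorProduct.tmul_smul]
    have hn' : (n : ℝ) ≠ 0 := by exact_mod_cast hn
    have : realEquiv Λ (1 ⊗ₜ u) = (n : ℝ)⁻¹ • (x : V) := by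
      rw [← hnx, inv_smul_smul₀ hn']
    simp only [SetLike.mem_coe]
    rw [this]
    refine Submodule.smul_mem _ _ (Submodule.subset_span ⟨?_, x.2⟩)
    rw [← hnx]
    exact U'.smul_mem _ (hmem u hu)
  rcases hsimple.2 UC hsub with h | h
  · left
    rw [Submodule.eq_bot_iff]
    intro u hu
    have h1 : realEquiv Λ (1 ⊗ₜ u) ∈ UC := hmem u hu
    rw [h, Submodule.mem_bot, LinearEquiv.map_eq_zero_iff] at h1
    exact Module.FaithfullyFlat.tensorProduct_mk_injective (A := ℚ) (B := ℝ) (RatLattice Λ)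
      (by simpa using h1)
  · right
    -- A nonzero functional vanishing on a proper `U` would, after base change, vanish on all of `ℝ
    -- ⊗ Λ_ℚ`.
    by_contra hne
    obtain ⟨φ, hφ, hφU⟩ := Submodule.exists_le_ker_of_lt_top U (lt_top_iff_ne_top.2 hne)
    have htop : U.baseChange ℝ = ⊤ := by
      have : U' = ⊤ := by rw [← hUC, h]; rfl
      exact Submodule.map_injective_of_injective (realEquiv Λ).injective (by
        rw [Submodule.map_top, LinearEquiv.range]; exact this)
    refine hφ (LinearMap.ext fun w => ?_)
    have hw : (1 : ℝ) ⊗ₜ[ℚ] w ∈ LinearMap.ker (φ.baseChange ℝ) := by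
      have hle : U.baseChange ℝ ≤ LinearMap.ker (φ.baseChange ℝ) := by
        rw [Submodule.baseChange_eq_span, Submodule.span_le]
        rintro _ ⟨u, hu, rfl⟩
        have : φ u = 0 := hφU hu
        simp [this]
      exact hle (htop ▸ Submodule.mem_top)
    simpa using hw

/-- Commuting with `J` makes `X_ℝ` complex linear, and `nX` preserves `Λ` for some `n ≠ 0`, so it
induces an endomorphism of `T`. Then `End⁰(T) = ℚ` gives `m n X = a` with integers `m ≠ 0` and `a`.
-/
theorem exists_eq_smul_one_of_commute (hend : EndAlgebraEqRat Λ)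
    (X : Module.End ℚ (RatLattice Λ)) (hX : Commute (complexStructure Λ) (1 ⊗ₜ X)) :
    ∃ c : ℚ, X = c • 1 := by
  obtain ⟨n, hn, hnX⟩ := exists_zsmul_map_one_tmul_eq X
  let F := realEndEquiv Λ (1 ⊗ₜ X)
  have hFI : ∀ v, F (Complex.I • v) = Complex.I • F v := by
    intro v
    have := congr(realEndEquiv Λ $(hX.eq) v)
    rw [map_mul, map_mul, Module.End.mul_apply, Module.End.mul_apply,
      realEndEquiv_complexStructure, realEndEquiv_complexStructure] at this
    exact this.symm
  let G : V →ₗ[ℂ] V :=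
    { toFun := fun v => n • F v
      map_add' := fun v w => by rw [map_add, smul_add]
      map_smul' := fun z v => by
        have h : ∀ w : V, z • w = z.re • w + z.im • (Complex.I • w) := fun w => by
          rw [← Complex.coe_smul, ← Complex.coe_smul, smul_smul, ← add_smul, Complex.re_add_im]
        rw [RingHom.id_apply, smul_comm z n, h v, h (F v), map_add, map_smul, map_smul, hFI] }
  have hG : ∀ x ∈ Λ, G x ∈ Λ := by
    intro x hx
    obtain ⟨y, hy⟩ := hnX ⟨x, hx⟩
    have h1 : F x = realEquiv Λ (1 ⊗ₜ X (1 ⊗ₜ ⟨x, hx⟩)) := by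
      have := realEndEquiv_tmul Λ 1 X 1 (1 ⊗ₜ ⟨x, hx⟩)
      rwa [realEquiv_one_tmul, one_mul] at this
    have h2 : G x = y := by
      change n • F x = y
      rw [h1, ← map_zsmul, ← TensorProduct.tmul_smul, hy, realEquiv_one_tmul]
    rw [h2]
    exact y.2
  obtain ⟨m, a, hm, hma⟩ := exists_zsmul_eq_of_map_mem Λ hend G hG
  refine ⟨a / (m * n), ?_⟩
  refine Module.FaithfullyFlat.tensorProduct_mk_injective (A := ℚ) (B := ℝ) _
    ((realEndEquiv Λ).injective (LinearMap.ext fun v => ?_))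
  have hc : (1 : ℝ) ⊗ₜ[ℚ] ((a / (m * n) : ℚ) • (1 : Module.End ℚ (RatLattice Λ))) =
      (a / (m * n) : ℝ) • 1 := by
    rw [← TensorProduct.smul_tmul, Algebra.TensorProduct.one_def, TensorProduct.smul_tmul']
    congr 1
    simp [Rat.smul_def]
  rw [TensorProduct.mk_apply, TensorProduct.mk_apply, hc, map_smul, map_one]
  change F v = (a / (m * n) : ℝ) • v
  have h1 : (m : ℝ) • (n : ℝ) • F v = (a : ℝ) • v := by
    rw [Int.cast_smul_eq_zsmul, Int.cast_smul_eq_zsmul, Int.cast_smul_eq_zsmul]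
    exact hma v
  have hm' : (m : ℝ) ≠ 0 := by exact_mod_cast hm
  have hn' : (n : ℝ) ≠ 0 := by exact_mod_cast hn
  rw [div_eq_inv_mul, mul_smul, ← h1, smul_smul, smul_smul, mul_assoc,
    inv_mul_cancel₀ (mul_ne_zero hm' hn'), one_smul]

end ComplexTorus

open ComplexTorus in
theorem mainTheorem12 {V : Type*} [NormedAddCommGroup V] [NormedSpace ℂ V]
    [FiniteDimensional ℂ V] (Λ : Submodule ℤ V) [DiscreteTopology Λ] [IsZLattice ℝ Λ]
    (hsimple : ComplexTorus.IsSimple Λ) (hend : ComplexTorus.EndAlgebraEqRat Λ) :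
    LieAlgebra.IsSimple ℚ (ComplexTorus.hodgeLie Λ) := by
  have : Nontrivial V := hsimple.1
  have : Nontrivial (ℝ ⊗[ℚ] RatLattice Λ) := (realEquiv Λ).toEquiv.nontrivial
  have : Nontrivial (RatLattice Λ) := by
    by_contra h
    rw [not_nontrivial_iff_subsingleton] at h
    exact not_subsingleton (ℝ ⊗[ℚ] RatLattice Λ) inferInstance
  -- `τ` moves `J` from `ℝ ⊗ End(Λ_ℚ)`, where real points live, to `End(ℝ ⊗ Λ_ℚ)`, where the
  -- Lie-theoretic criterion is stated; its injectivity brings commutation with `J` back.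
  let τ := LinearMap.tensorProductEnd ℚ ℝ (RatLattice Λ)
  have hτ : ∀ X : Module.End ℚ (RatLattice Λ), τ (1 ⊗ₜ X) = X.baseChange ℝ := fun X =>
    one_smul ℝ (X.baseChange ℝ)
  have hinj : Function.Injective τ := fun x y hxy => (realEndEquiv Λ).injective (by
    ext v
    obtain ⟨p, rfl⟩ := (realEquiv Λ).surjective v
    rw [realEndEquiv_realEquiv, realEndEquiv_realEquiv]
    exact congr(realEquiv Λ ($hxy p)))
  refine LieSubalgebra.isSimple_of_sq_eq_neg_one (hodgeLie Λ) (hodgeLie_irreducible Λ hsimple)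
    (fun X hX => trace_eq_zero_of_mem_hodgeLie Λ hX) (τ (complexStructure Λ)) ?_ ?_ ?_
  · rw [← map_mul, complexStructure_mul_self, map_neg]
    exact congrArg Neg.neg τ.map_one'
  · have := Submodule.mem_map_of_mem (f := τ.toLinearMap) (complexStructure_mem_span Λ)
    rw [Submodule.map_span, Set.image_image] at this
    simpa only [AlgHom.toLinearMap_apply, hτ] using this
  · intro X hX
    refine exists_eq_smul_one_of_commute Λ hend X (hinj ?_)
    rw [map_mul, map_mul, hτ]
    exact hX
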